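/- Let $\lambda>0$ and $b>0$ be real numbers, and let $X$ be a real random variable with the standard Cauchy distribution, i.e. with density $\frac{1}{\pi(1+x^2)}$ on $\mathbb{R}$. For complex arguments let $\ln$ and $\sqrt{\cdot}$ denote the principal branches (cut along $(-\infty,0]$), and let $\ln^b(w)=(\ln w)^b$, where the $b$-th power is the principal one, with $0^b=0$. Then the three random variables $\ln^b(1+\sqrt{\lambda|X|})$, $\ln^b(1+i\sqrt{\lambda|X|})$ and $\ln^b(1-i\sqrt{\lambda|X|})$ are integrable, and $$ \mathbb{E}\ln^b\bigl(1+\sqrt{\lambda|X|}\bigr)=\ln^b\bigl(1+\sqrt{i\lambda}\bigr)+\ln^b\bigl(1+\sqrt{-i\lambda}\bigr)-\frac12\,\mathbb{E}\ln^b\bigl(1+i\sqrt{\lambda|X|}\bigr)-\frac12\,\mathbb{E}\ln^b\bigl(1-i\sqrt{\lambda|X|}\bigr). $$ -/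

import Mathlib

open MeasureTheory ProbabilityTheory

/-! The standard Cauchy law is the harmonic measure of the upper half plane seen from `I`. So a
function `g` that is holomorphic there, continuous up to the real line and of growth at most `√‖z‖`
has Cauchy mean `g I` (`integral_cauchyMeasure_eq_apply_I`, transported from circle averages by the
Cayley map).

Take `g z = log (1 + sqrt (l z)) ^ b`. Its boundary value is the first integrand for `x ≥ 0` and the
one with `+I` for `x ≤ 0`. Since the law is symmetric, these two expectations add up to `2 * g I`
(`integral_log_one_add_sqrt_cpow`). Averaging this identity with its complex conjugate gives the
theorem. -/

lemma integral_cauchyMeasure_zero_one (f : ℝ → ℂ) :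
    ∫ x, f x ∂(cauchyMeasure 0 1) = ∫ x, (Real.pi⁻¹ * (1 + x ^ 2)⁻¹) • f x := by
  rw [cauchyMeasure_of_scale_ne_zero 0 one_ne_zero,
    integral_withDensity_eq_integral_toReal_smul (by fun_prop)
      (Filter.Eventually.of_forall fun x => by simp [cauchyPDF_def])]
  refine integral_congr_ae (Filter.Eventually.of_forall fun x => ?_)
  have : (cauchyPDF 0 1 x).toReal = Real.pi⁻¹ * (1 + x ^ 2)⁻¹ := by
    rw [cauchyPDF_def, ENNReal.toReal_ofReal (cauchyPDF_pos 0 one_ne_zero x).le, cauchyPDFReal_def]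
    simp [add_comm]
  simp only [this]

lemma integral_cauchyMeasure_comp_neg (f : ℝ → ℂ) :
    ∫ x, f (-x) ∂(cauchyMeasure 0 1) = ∫ x, f x ∂(cauchyMeasure 0 1) := by
  rw [integral_cauchyMeasure_zero_one, integral_cauchyMeasure_zero_one,
    ← integral_neg_eq_self (fun x : ℝ => (Real.pi⁻¹ * (1 + x ^ 2)⁻¹) • f x)]
  simp

/-- This is the dominating function used throughout: growth `|x|^(1/2)` against the density leaves a
tail of order `|x|^(-3/2)`. -/
lemma integrable_cauchyMeasure_one_add_sqrt_sqrt :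
    Integrable (fun x : ℝ => 1 + √(√(1 + x ^ 2))) (cauchyMeasure 0 1) := by
  refine (integrable_const 1).add ?_
  rw [cauchyMeasure_of_scale_ne_zero 0 one_ne_zero,
    integrable_withDensity_iff (by fun_prop)
      (Filter.Eventually.of_forall fun x => by simp [cauchyPDF_def])]
  have h : Integrable (fun x : ℝ => ((1 : ℝ) + ‖x‖ ^ 2) ^ (-(3 / 2 : ℝ) / 2)) :=
    integrable_rpow_neg_one_add_norm_sq (by norm_num)
  refine (h.const_mul Real.pi⁻¹).congr (Filter.Eventually.of_forall fun x => ?_)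
  have hx : 0 < 1 + x ^ 2 := by positivity
  simp only
  rw [cauchyPDF_def, ENNReal.toReal_ofReal (cauchyPDF_pos 0 one_ne_zero x).le, cauchyPDFReal_def]
  have e : √(√(1 + x ^ 2)) * (1 + x ^ 2)⁻¹ = (1 + x ^ 2) ^ (-(3 / 2 : ℝ) / 2) := by
    rw [Real.sqrt_eq_rpow, Real.sqrt_eq_rpow, ← Real.rpow_mul hx.le, ← Real.rpow_neg_one,
      ← Real.rpow_add hx]
    norm_num
  rw [Real.norm_eq_abs, sq_abs, ← e]
  simp [add_comm]
  ring

/-! ### Cauchy law, circle averages and the Poisson formula -/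

lemma integral_cauchyMeasure_comp_arctan (f : ℝ → ℂ) :
    ∫ x, f (Real.arctan x) ∂(cauchyMeasure 0 1) =
      Real.pi⁻¹ • ∫ u in (-(Real.pi / 2))..(Real.pi / 2), f u := by
  have h := integral_image_eq_integral_abs_deriv_smul (s := Set.univ) MeasurableSet.univ
    (fun x _ => (Real.hasDerivAt_arctan' x).hasDerivWithinAt) Real.arctan_injective.injOn f
  rw [Set.image_univ, Real.range_arctan] at h
  rw [integral_cauchyMeasure_zero_one, intervalIntegral.integral_of_le
    (by linarith [Real.pi_pos]), integral_Ioc_eq_integral_Ioo, h, ← integral_smul]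
  simp only [Measure.restrict_univ]
  refine integral_congr_ae (Filter.Eventually.of_forall fun x => ?_)
  have hx : 0 < (1 + x ^ 2)⁻¹ := by positivity
  simp only [abs_of_pos hx, mul_smul]

/-- Under the Cauchy law `2 * arctan x` is a uniform angle on `(-π, π)`; periodicity moves the
window to `(0, 2π)`. -/
lemma circleAverage_eq_integral_cauchyMeasure (h : ℂ → ℂ) (r : ℝ) :
    Real.circleAverage h 0 r =
      ∫ x, h (circleMap 0 r (2 * Real.arctan x)) ∂(cauchyMeasure 0 1) := by
  rw [integral_cauchyMeasure_comp_arctan (fun u => h (circleMap 0 r (2 * u))),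
    intervalIntegral.integral_comp_mul_left (fun θ => h (circleMap 0 r θ)) two_ne_zero,
    Real.circleAverage_def]
  have hp : Function.Periodic (fun θ => h (circleMap 0 r θ)) (2 * Real.pi) := fun θ => by
    simp [periodic_circleMap 0 r θ]
  have := hp.intervalIntegral_add_eq 0 (-Real.pi)
  rw [zero_add, show -Real.pi + 2 * Real.pi = Real.pi by ring] at this
  rw [this, smul_smul]
  congr 2
  · ring
  · ring
  · ring

lemma circleMap_two_mul_arctan (r x : ℝ) :
    circleMap 0 r (2 * Real.arctan x) =
      r * ((1 + Complex.I * x) / (1 - Complex.I * x)) := by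
  have hx : 0 < 1 + x ^ 2 := by positivity
  have h1 : (1 - Complex.I * x) ≠ 0 := fun h => by
    have := congrArg Complex.re h
    simp at this
  have e : Complex.exp (Real.arctan x * Complex.I) = (1 + Complex.I * x) / (√(1 + x ^ 2) : ℝ) := by
    rw [Complex.exp_mul_I, ← Complex.ofReal_cos, ← Complex.ofReal_sin, Real.cos_arctan,
      Real.sin_arctan]
    push_cast
    ring
  have hs : ((√(1 + x ^ 2) : ℝ) : ℂ) ^ 2 = 1 + (x : ℂ) ^ 2 := by
    rw [← Complex.ofReal_pow, Real.sq_sqrt hx.le]; push_cast; rfl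
  have hx' : (1 + (x : ℂ) ^ 2) ≠ 0 := by exact_mod_cast hx.ne'
  rw [circleMap, zero_add]
  congr 1
  rw [show ((2 * Real.arctan x : ℝ) : ℂ) * Complex.I = (2 : ℕ) * (Real.arctan x * Complex.I) by
    push_cast; ring, Complex.exp_nat_mul, e, div_pow, hs, div_eq_div_iff hx' h1]
  ring_nf
  simp [Complex.I_sq, show Complex.I ^ 3 = -Complex.I from by rw [pow_succ, Complex.I_sq]; ring]
  ring

lemma cayley_im_pos {ζ : ℂ} (hζ : ‖ζ‖ < 1) : 0 < (Complex.I * (1 - ζ) / (1 + ζ)).im := by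
  have h : 1 + ζ ≠ 0 := fun h => by
    rw [eq_neg_of_add_eq_zero_right h] at hζ; simp at hζ
  have hn : 0 < Complex.normSq (1 + ζ) := Complex.normSq_pos.2 h
  have h2 : Complex.normSq ζ < 1 := by
    rw [Complex.normSq_eq_norm_sq]; nlinarith [norm_nonneg ζ]
  rw [Complex.normSq_apply] at h2
  rw [Complex.div_im, ← sub_div]
  refine div_pos ?_ hn
  simp
  nlinarith

/-- The Poisson formula at `I` for the upper half plane. -/
lemma integral_cauchyMeasure_eq_apply_I {g : ℂ → ℂ} {C : ℝ}
    (hd : ∀ z : ℂ, 0 < z.im → DifferentiableAt ℂ g z)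
    (hc : ContinuousOn g {z | 0 ≤ z.im})
    (hC : ∀ z : ℂ, 0 ≤ z.im → ‖g z‖ ≤ C * (1 + √‖z‖)) :
    ∫ x : ℝ, g x ∂(cauchyMeasure 0 1) = g Complex.I := by
  have hC0 : 0 ≤ C := by simpa using (norm_nonneg _).trans (hC 0 (by simp))
  -- Cayley map from the disc to the half plane, with `φ 0 = I`. The point of the unit circle at
  -- angle `2 * arctan x` goes to `x`. Radii `r < 1` avoid the pole at `-1`; then `r → 1`.
  let φ : ℂ → ℂ := fun ζ => Complex.I * (1 - ζ) / (1 + ζ)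
  have hmem {r : ℝ} (hr : r ∈ Set.Ioo (0 : ℝ) 1) (θ : ℝ) : ‖circleMap 0 r θ‖ < 1 := by
    simpa [circleMap, abs_of_pos hr.1] using hr.2
  have hmean : ∀ r ∈ Set.Ioo (0 : ℝ) 1,
      ∫ x : ℝ, g (φ (circleMap 0 r (2 * Real.arctan x))) ∂(cauchyMeasure 0 1) = g Complex.I := by
    intro r hr
    rw [← circleAverage_eq_integral_cauchyMeasure (fun ζ => g (φ ζ)) r,
      circleAverage_of_differentiable_on_off_countable (s := ∅) Set.countable_empty]
    · simp [φ]
    all_goals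
      have hdiff : ∀ ζ : ℂ, ‖ζ‖ < 1 → DifferentiableAt ℂ (fun ζ => g (φ ζ)) ζ := fun ζ hζ => by
        have h : 1 + ζ ≠ 0 := fun h => by
          rw [eq_neg_of_add_eq_zero_right h] at hζ; simp at hζ
        exact (hd _ (cayley_im_pos hζ)).comp ζ
          (((differentiableAt_const _).mul ((differentiableAt_const _).sub
            differentiableAt_id)).div ((differentiableAt_const _).add differentiableAt_id) h)
    · intro ζ hζ
      rw [mem_closedBall_zero_iff, abs_of_pos hr.1] at hζ
      exact (hdiff ζ (hζ.trans_lt hr.2)).continuousAt.continuousWithinAt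
    · intro ζ hζ
      have := hζ.1
      rw [mem_ball_zero_iff, abs_of_pos hr.1] at this
      exact hdiff ζ (this.trans hr.2)
  have hden (x : ℝ) : (1 - Complex.I * x) ≠ 0 := fun h => by
    have := congrArg Complex.re h
    simp at this
  have hform (r : ℝ) (hr : 0 ≤ r) (x : ℝ) : φ (circleMap 0 r (2 * Real.arctan x)) =
      (x * (1 + r) + Complex.I * (1 - r)) / ((1 + r) - Complex.I * x * (1 - r)) := by
    have h2 : ((1 + r : ℂ) - Complex.I * x * (1 - r)) ≠ 0 := fun h => by
      have := congrArg Complex.re h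
      simp at this
      linarith
    have h3 : 1 + r * ((1 + Complex.I * x) / (1 - Complex.I * x)) =
      ((1 + r : ℂ) - Complex.I * x * (1 - r)) / (1 - Complex.I * x) := by
      field_simp [hden x]; ring
    simp only [φ, circleMap_two_mul_arctan]
    rw [h3, div_div_eq_mul_div]
    congr 1
    have := hden x
    field_simp
    linear_combination (x * (1 + r) : ℂ) * (-1) * Complex.I_sq
  -- A bound uniform in `r`, as dominated convergence requires.
  have hnorm : ∀ r ∈ Set.Ioo (0 : ℝ) 1, ∀ x : ℝ,
      ‖φ (circleMap 0 r (2 * Real.arctan x))‖ ≤ √(1 + x ^ 2) := by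
    intro r hr x
    have h2 : ((1 + r : ℂ) - Complex.I * x * (1 - r)) ≠ 0 := fun h => by
      have := congrArg Complex.re h
      simp at this
      linarith [hr.1]
    rw [hform r hr.1.le]
    apply Real.le_sqrt_of_sq_le
    rw [norm_div, div_pow, div_le_iff₀ (by positivity), ← Complex.normSq_eq_norm_sq,
      ← Complex.normSq_eq_norm_sq, Complex.normSq_apply, Complex.normSq_apply]
    simp
    have := hr.1
    nlinarith [mul_nonneg (mul_nonneg (sq_nonneg x) (sq_nonneg (1 - r))) (sq_nonneg x),
      mul_nonneg (sq_nonneg x) (sq_nonneg (1 - r))]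
  have hlim : Filter.Tendsto (fun r : ℝ => ∫ x : ℝ,
      g (φ (circleMap 0 r (2 * Real.arctan x))) ∂(cauchyMeasure 0 1)) (nhdsWithin 1 (Set.Iio 1))
      (nhds (∫ x : ℝ, g x ∂(cauchyMeasure 0 1))) := by
    have hev : ∀ᶠ r : ℝ in nhdsWithin 1 (Set.Iio 1), r ∈ Set.Ioo (0 : ℝ) 1 :=
      Ioo_mem_nhdsLT zero_lt_one
    refine tendsto_integral_filter_of_dominated_convergence
      (fun x => C * (1 + √(√(1 + x ^ 2)))) ?_ ?_
      (integrable_cauchyMeasure_one_add_sqrt_sqrt.const_mul C) ?_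
    · filter_upwards [hev] with r hr
      refine Continuous.aestronglyMeasurable ?_
      rw [continuous_iff_continuousAt]
      intro x
      have hζ := hmem hr (2 * Real.arctan x)
      have h : 1 + circleMap 0 r (2 * Real.arctan x) ≠ 0 := fun h => by
        rw [eq_neg_of_add_eq_zero_right h] at hζ; simp at hζ
      have hcm : ContinuousAt (fun x : ℝ => circleMap 0 r (2 * Real.arctan x)) x :=
        ((continuous_circleMap 0 r).comp
          (continuous_const.mul Real.continuous_arctan)).continuousAt
      exact ContinuousAt.comp (f := fun x : ℝ => φ (circleMap 0 r (2 * Real.arctan x)))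
        (hd _ (cayley_im_pos hζ)).continuousAt
        ((continuousAt_const.mul (continuousAt_const.sub hcm)).div (continuousAt_const.add hcm) h)
    · filter_upwards [hev] with r hr
      refine Filter.Eventually.of_forall fun x => (hC _ (cayley_im_pos (hmem hr _)).le).trans ?_
      gcongr
      exact hnorm r hr x
    · refine Filter.Eventually.of_forall fun x => ?_
      refine (hc (x : ℂ) (by simp)).tendsto.comp (tendsto_nhdsWithin_iff.2 ⟨?_, ?_⟩)
      · have hcont : ContinuousAt (fun r : ℝ => (x * (1 + r) + Complex.I * (1 - r) : ℂ) /
            ((1 + r) - Complex.I * x * (1 - r))) 1 := by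
          refine ContinuousAt.div (by fun_prop) (by fun_prop) ?_
          norm_num
        have := hcont.tendsto.mono_left (nhdsWithin_le_nhds (s := Set.Iio 1))
        have e : (x * (1 + (1 : ℝ)) + Complex.I * (1 - (1 : ℝ)) : ℂ) /
            ((1 + (1 : ℝ)) - Complex.I * x * (1 - (1 : ℝ))) = x := by
          push_cast; ring
        rw [e] at this
        refine this.congr' ?_
        filter_upwards [hev] with r hr
        exact (hform r hr.1.le x).symm
      · filter_upwards [hev] with r hr
        exact (cayley_im_pos (hmem hr _)).le
  refine tendsto_nhds_unique hlim (tendsto_const_nhds.congr' ?_)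
  filter_upwards [Ioo_mem_nhdsLT (zero_lt_one (α := ℝ))] with r hr
  exact (hmean r hr).symm

/-! ### Principal square root and powers of `log (1 + w)` -/

lemma re_sqrt_nonneg (z : ℂ) : 0 ≤ (Complex.sqrt z).re := by
  rw [Complex.sqrt, Complex.cpow_inv_two_re]
  exact Real.sqrt_nonneg _

lemma norm_sqrt (z : ℂ) : ‖Complex.sqrt z‖ = √‖z‖ := by
  have := Complex.norm_cpow_real z 2⁻¹
  rw [Complex.sqrt, Real.sqrt_eq_rpow, one_div, ← this]
  push_cast
  rfl

/-- On the cut the principal value is the limit from above, so no jump is seen from the closed upper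
half plane. -/
lemma continuousOn_sqrt_im_nonneg : ContinuousOn Complex.sqrt {z | 0 ≤ z.im} := by
  have h : Continuous fun a : ℂ =>
      ((√((‖a‖ + a.re) / 2) : ℝ) : ℂ) + 1 * (√((‖a‖ - a.re) / 2) : ℝ) * Complex.I := by
    fun_prop
  refine h.continuousOn.congr fun z hz => ?_
  simp only [Complex.sqrt_eq_real_add_ite, if_pos (show 0 ≤ z.im from hz)]

lemma sqrt_conj {z : ℂ} (h : z.arg ≠ Real.pi) :
    Complex.sqrt (starRingEnd ℂ z) = starRingEnd ℂ (Complex.sqrt z) := by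
  rw [Complex.sqrt, Complex.sqrt, Complex.conj_cpow _ _ h, map_inv₀, Complex.conj_ofNat]

lemma log_one_add_re_nonneg {w : ℂ} (hw : 0 ≤ w.re) : 0 ≤ (Complex.log (1 + w)).re := by
  rw [Complex.log_re]
  refine Real.log_nonneg (le_trans ?_ (Complex.re_le_norm _))
  simpa using hw

lemma one_add_mem_slitPlane {w : ℂ} (hw : 0 ≤ w.re) : 1 + w ∈ Complex.slitPlane :=
  Or.inl (by simp; linarith)

/-- The logarithm has nonnegative real part, so it meets the cut of the power only at `0`, where `b
> 0` gives continuity. -/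
lemma continuousAt_log_one_add_cpow {b : ℝ} (hb : 0 < b) {w : ℂ} (hw : 0 ≤ w.re) :
    ContinuousAt (fun w => Complex.log (1 + w) ^ (b : ℂ)) w :=
  ContinuousAt.comp (g := fun v : ℂ => v ^ (b : ℂ))
    (Complex.continuousAt_cpow_const_of_re_pos (Or.inl (log_one_add_re_nonneg hw)) (by simpa))
    ((continuousAt_const.add continuousAt_id).clog (one_add_mem_slitPlane hw))

lemma differentiableAt_log_one_add_cpow (b : ℂ) {w : ℂ} (hw : 0 < w.re) :
    DifferentiableAt ℂ (fun w => Complex.log (1 + w) ^ b) w := by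
  refine DifferentiableAt.cpow
    (((differentiableAt_const _).add differentiableAt_id).clog (one_add_mem_slitPlane hw.le))
    (differentiableAt_const _) (Or.inl ?_)
  rw [Complex.log_re]
  refine Real.log_pos (lt_of_lt_of_le ?_ (Complex.re_le_norm _))
  simpa using hw

/-- The factor `exp π` absorbs the argument of `1 + w`; then `log y ≤ b * y ^ (1 / b)`, whose
exponent makes the `b`-th power linear in `y`. -/
lemma norm_log_one_add_cpow_le {b : ℝ} (hb : 0 < b) {w : ℂ} (hw : 0 ≤ w.re) :
    ‖Complex.log (1 + w) ^ (b : ℂ)‖ ≤ Real.exp Real.pi * b ^ b * (1 + ‖w‖) := by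
  have h1 : 1 ≤ ‖1 + w‖ := le_trans (by simpa using hw) (Complex.re_le_norm _)
  have hy : 0 < Real.exp Real.pi * (1 + ‖w‖) := by positivity
  have hlog : ‖Complex.log (1 + w)‖ ≤ Real.log (Real.exp Real.pi * (1 + ‖w‖)) := by
    rw [Real.log_mul (Real.exp_pos _).ne' (by positivity), Real.log_exp, add_comm Real.pi]
    refine (Complex.norm_le_abs_re_add_abs_im _).trans (add_le_add ?_ ?_)
    · rw [Complex.log_re, abs_of_nonneg (Real.log_nonneg h1)]
      exact Real.log_le_log (by linarith) ((norm_add_le _ _).trans (by simp))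
    · rw [Complex.log_im]; exact Complex.abs_arg_le_pi _
  rw [Complex.norm_cpow_real]
  calc ‖Complex.log (1 + w)‖ ^ b
      ≤ ((Real.exp Real.pi * (1 + ‖w‖)) ^ (1 / b) / (1 / b)) ^ b := by
        gcongr
        exact hlog.trans (Real.log_le_rpow_div hy.le (by positivity))
    _ = Real.exp Real.pi * b ^ b * (1 + ‖w‖) := by
        rw [div_div_eq_mul_div, div_one, Real.mul_rpow (by positivity) hb.le, ← Real.rpow_mul hy.le,
          one_div_mul_cancel hb.ne', Real.rpow_one]
        ring

lemma norm_log_one_add_cpow_le_of_norm_le {b : ℝ} (hb : 0 < b) {l : ℝ} {w : ℂ}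
    (hw : 0 ≤ w.re) {t : ℝ} (ht : ‖w‖ ≤ √l * t) (ht0 : 0 ≤ t) :
    ‖Complex.log (1 + w) ^ (b : ℂ)‖ ≤ Real.exp Real.pi * b ^ b * (1 + √l) * (1 + t) := by
  refine (norm_log_one_add_cpow_le hb hw).trans ?_
  rw [mul_assoc _ (1 + √l)]
  gcongr
  nlinarith [Real.sqrt_nonneg l]

lemma integrable_log_one_add_cpow {b : ℝ} (hb : 0 < b) {l : ℝ} (hl : 0 < l) {c : ℂ}
    (hc : 0 ≤ c.re) (hc1 : ‖c‖ ≤ 1) :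
    Integrable (fun x : ℝ => Complex.log (1 + c * (√(l * |x|) : ℝ)) ^ (b : ℂ))
      (cauchyMeasure 0 1) := by
  have hre (x : ℝ) : 0 ≤ (c * (√(l * |x|) : ℝ)).re := by
    rw [Complex.re_mul_ofReal]; positivity
  refine (integrable_cauchyMeasure_one_add_sqrt_sqrt.const_mul
    (Real.exp Real.pi * b ^ b * (1 + √l))).mono' ?_ (Filter.Eventually.of_forall fun x => ?_)
  · refine Continuous.aestronglyMeasurable (continuous_iff_continuousAt.2 fun x => ?_)
    exact ContinuousAt.comp (f := fun x : ℝ => c * (√(l * |x|) : ℝ))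
      (continuousAt_log_one_add_cpow hb (hre x)) (by fun_prop)
  · refine norm_log_one_add_cpow_le_of_norm_le hb (hre x) ?_ (Real.sqrt_nonneg _)
    rw [norm_mul, Complex.norm_real, Real.norm_of_nonneg (Real.sqrt_nonneg _),
      Real.sqrt_mul hl.le]
    refine (mul_le_of_le_one_left (by positivity) hc1).trans ?_
    gcongr
    exact Real.abs_le_sqrt (by linarith)

/-! ### Boundary values and the final identity -/

lemma sqrt_ofReal_of_nonneg {x : ℝ} (hx : 0 ≤ x) : Complex.sqrt x = (√x : ℝ) := by
  rw [Complex.sqrt_of_nonneg (by exact_mod_cast hx), Complex.ofReal_re]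

lemma sqrt_ofReal_of_nonpos {x : ℝ} (hx : x ≤ 0) : Complex.sqrt x = Complex.I * (√(-x) : ℝ) := by
  rw [← sqrt_ofReal_of_nonneg (neg_nonneg.2 hx),
    ← Complex.sqrt_neg_of_nonneg (by exact_mod_cast neg_nonneg.2 hx)]
  simp

lemma integral_log_one_add_sqrt_cpow {b : ℝ} (hb : 0 < b) {l : ℝ} (hl : 0 < l) :
    ∫ x : ℝ, Complex.log (1 + (√(l * |x|) : ℝ)) ^ (b : ℂ) ∂(cauchyMeasure 0 1) +
      ∫ x : ℝ, Complex.log (1 + Complex.I * (√(l * |x|) : ℝ)) ^ (b : ℂ) ∂(cauchyMeasure 0 1) =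
    2 * Complex.log (1 + Complex.sqrt (Complex.I * l)) ^ (b : ℂ) := by
  let g : ℂ → ℂ := fun z => Complex.log (1 + Complex.sqrt (z * l)) ^ (b : ℂ)
  have him (z : ℂ) : (z * l).im = z.im * l := Complex.im_mul_ofReal z l
  have hcont : ContinuousOn g {z | 0 ≤ z.im} := by
    intro z hz
    have hz' : 0 ≤ (z * l).im := by rw [him]; exact mul_nonneg hz hl.le
    refine ContinuousAt.comp_continuousWithinAt (f := fun z : ℂ => Complex.sqrt (z * l))
      (continuousAt_log_one_add_cpow hb (re_sqrt_nonneg _)) ?_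
    exact ContinuousWithinAt.comp (f := fun z : ℂ => z * l) (continuousOn_sqrt_im_nonneg _ hz')
      (by fun_prop) fun w hw => by
        change 0 ≤ (w * l).im
        rw [him]; exact mul_nonneg hw hl.le
  have hbound (z : ℂ) :
      ‖g z‖ ≤ Real.exp Real.pi * b ^ b * (1 + √l) * (1 + √‖z‖) := by
    refine norm_log_one_add_cpow_le_of_norm_le hb (re_sqrt_nonneg _) ?_ (Real.sqrt_nonneg _)
    rw [norm_sqrt, norm_mul, Complex.norm_real, Real.norm_of_nonneg hl.le, mul_comm,
      Real.sqrt_mul hl.le]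
  have hpoisson : ∫ x : ℝ, g x ∂(cauchyMeasure 0 1) = g Complex.I := by
    refine integral_cauchyMeasure_eq_apply_I (fun z hz => ?_) hcont fun z _ => hbound z
    have hz' : 0 < (z * l).im := by rw [him]; exact mul_pos hz hl
    refine DifferentiableAt.comp (f := fun z : ℂ => Complex.sqrt (z * l)) z
      (differentiableAt_log_one_add_cpow _ ?_) ?_
    -- A vanishing real part would force `‖z * l‖ ≤ -(z * l).re`, impossible off the real axis.
    · refine (re_sqrt_nonneg _).lt_of_ne' fun h => ?_
      rw [Complex.sqrt, Complex.cpow_inv_two_re, Real.sqrt_eq_zero'] at h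
      have := Complex.abs_re_lt_norm.2 hz'.ne'
      linarith [neg_abs_le (z * l).re]
    · exact DifferentiableAt.comp (f := fun z : ℂ => z * l) z
        (Complex.differentiableAt_sqrt (Or.inr hz'.ne')) (by fun_prop)
  have hint : Integrable (fun x : ℝ => g x) (cauchyMeasure 0 1) := by
    refine (integrable_cauchyMeasure_one_add_sqrt_sqrt.const_mul
      (Real.exp Real.pi * b ^ b * (1 + √l))).mono' ?_ (Filter.Eventually.of_forall fun x => ?_)
    · exact (hcont.comp_continuous Complex.continuous_ofReal (by simp)).aestronglyMeasurable
    · refine (hbound x).trans ?_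
      gcongr
      rw [Complex.norm_real]
      exact Real.abs_le_sqrt (by linarith)
  have hneg := integral_cauchyMeasure_comp_neg (fun x : ℝ => g x)
  have hint' : Integrable (fun x : ℝ => g (-x : ℝ)) (cauchyMeasure 0 1) := by
    refine (integrable_cauchyMeasure_one_add_sqrt_sqrt.const_mul
      (Real.exp Real.pi * b ^ b * (1 + √l))).mono' ?_ (Filter.Eventually.of_forall fun x => ?_)
    · exact (hcont.comp_continuous (Complex.continuous_ofReal.comp continuous_neg)
        (by simp)).aestronglyMeasurable
    · refine (hbound _).trans ?_
      gcongr
      rw [Complex.norm_real, norm_neg]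
      exact Real.abs_le_sqrt (by linarith)
  have hpos {x : ℝ} (hx : 0 ≤ x) : g x = Complex.log (1 + (√(l * x) : ℝ)) ^ (b : ℂ) := by
    simp only [g]
    rw [← Complex.ofReal_mul, sqrt_ofReal_of_nonneg (by positivity), mul_comm]
  have hnonpos {x : ℝ} (hx : 0 ≤ x) :
      g (-x : ℝ) = Complex.log (1 + Complex.I * (√(l * x) : ℝ)) ^ (b : ℂ) := by
    simp only [g]
    rw [← Complex.ofReal_mul, sqrt_ofReal_of_nonpos (by nlinarith), neg_mul, neg_neg, mul_comm x]
  calc _ = ∫ x : ℝ, (g x + g (-x : ℝ)) ∂(cauchyMeasure 0 1) := by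
        rw [← integral_add
          (by simpa using integrable_log_one_add_cpow hb hl (c := 1) (by simp) (by simp))
          (integrable_log_one_add_cpow hb hl (by simp) (by simp))]
        refine integral_congr_ae (Filter.Eventually.of_forall fun x => ?_)
        simp only
        rw [← hpos (abs_nonneg x), ← hnonpos (abs_nonneg x)]
        -- For negative `x` the two summands merely swap.
        rcases abs_cases x with ⟨h, _⟩ | ⟨h, _⟩
        · rw [h]
        · rw [h, neg_neg, add_comm]
    _ = _ := by
        rw [integral_add hint hint', hneg, hpoisson, two_mul]

lemma log_one_add_cpow_conj {w : ℂ} (hw : 0 ≤ w.re) (b : ℝ) :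
    Complex.log (1 + starRingEnd ℂ w) ^ (b : ℂ) =
      starRingEnd ℂ (Complex.log (1 + w) ^ (b : ℂ)) := by
  have h1 : (Complex.log (1 + w)).arg ≠ Real.pi := fun h => by
    rw [Complex.arg_eq_pi_iff] at h
    exact absurd h.1 (log_one_add_re_nonneg hw).not_gt
  rw [show 1 + starRingEnd ℂ w = starRingEnd ℂ (1 + w) by simp,
    Complex.log_conj _ (Complex.slitPlane_arg_ne_pi (one_add_mem_slitPlane hw)),
    Complex.conj_cpow _ _ h1, Complex.conj_ofReal]

theorem mainTheorem2 {Ω : Type*} [MeasurableSpace Ω] (P : Measure Ω) [IsProbabilityMeasure P]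
    (X : Ω → ℝ) (hX : HasLaw X (cauchyMeasure 0 1) P)
    (l : ℝ) (hl : 0 < l) (b : ℝ) (hb : 0 < b) :
    Integrable (fun ω => Real.log (1 + Real.sqrt (l * |X ω|)) ^ b) P ∧
    Integrable (fun ω =>
      Complex.log (1 + Complex.I * (Real.sqrt (l * |X ω|) : ℂ)) ^ (b : ℂ)) P ∧
    Integrable (fun ω =>
      Complex.log (1 - Complex.I * (Real.sqrt (l * |X ω|) : ℂ)) ^ (b : ℂ)) P ∧
    ((∫ ω, Real.log (1 + Real.sqrt (l * |X ω|)) ^ b ∂P : ℝ) : ℂ) =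
      Complex.log (1 + Complex.sqrt (Complex.I * (l : ℂ))) ^ (b : ℂ)
      + Complex.log (1 + Complex.sqrt (-Complex.I * (l : ℂ))) ^ (b : ℂ)
      - (1 / 2 : ℂ) *
        ∫ ω, Complex.log (1 + Complex.I * (Real.sqrt (l * |X ω|) : ℂ)) ^ (b : ℂ) ∂P
      - (1 / 2 : ℂ) *
        ∫ ω, Complex.log (1 - Complex.I * (Real.sqrt (l * |X ω|) : ℂ)) ^ (b : ℂ) ∂P := by
  have hcast (x : ℝ) : Complex.log (1 + (√(l * |x|) : ℝ)) ^ (b : ℂ) =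
      ((Real.log (1 + √(l * |x|)) ^ b : ℝ) : ℂ) := by
    have h1 : 1 ≤ 1 + √(l * |x|) := by linarith [Real.sqrt_nonneg (l * |x|)]
    rw [Complex.ofReal_cpow (Real.log_nonneg h1), Complex.ofReal_log (by linarith)]
    push_cast
    rfl
  have hconj (x : ℝ) : Complex.log (1 - Complex.I * (√(l * |x|) : ℝ)) ^ (b : ℂ) =
      starRingEnd ℂ (Complex.log (1 + Complex.I * (√(l * |x|) : ℝ)) ^ (b : ℂ)) := by
    rw [← log_one_add_cpow_conj (by simp)]
    simp [sub_eq_add_neg]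
  have h1 : Integrable (fun x : ℝ => Real.log (1 + √(l * |x|)) ^ b) (cauchyMeasure 0 1) := by
    have := (integrable_log_one_add_cpow hb hl (c := 1) (by simp) (by simp)).re
    simpa only [one_mul, hcast, RCLike.re_to_complex, Complex.ofReal_re] using this
  have h2 := integrable_log_one_add_cpow hb hl (c := Complex.I) (by simp) (by simp)
  have h3 : Integrable (fun x : ℝ => Complex.log (1 - Complex.I * (√(l * |x|) : ℝ)) ^ (b : ℂ))
      (cauchyMeasure 0 1) := by
    simpa [sub_eq_add_neg] using integrable_log_one_add_cpow hb hl (c := -Complex.I)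
      (by simp) (by simp)
  have hX' := hX.map_eq
  refine ⟨(hX'.symm ▸ h1).comp_aemeasurable hX.aemeasurable,
    (hX'.symm ▸ h2).comp_aemeasurable hX.aemeasurable,
    (hX'.symm ▸ h3).comp_aemeasurable hX.aemeasurable, ?_⟩
  have e1 := hX.integral_comp h1.aestronglyMeasurable
  have e2 := hX.integral_comp h2.aestronglyMeasurable
  have e3 := hX.integral_comp h3.aestronglyMeasurable
  simp only [Function.comp_def] at e1 e2 e3
  rw [e1, e2, e3]
  have key := integral_log_one_add_sqrt_cpow hb hl
  simp only [hcast] at key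
  rw [integral_complex_ofReal] at key
  -- Conjugation fixes the real expectation, turns `+I` into `-I` in the other, and `sqrt (I * l)`
  -- into `sqrt (-I * l)`.
  have key' := congrArg (starRingEnd ℂ) key
  have harg : (Complex.I * l).arg ≠ Real.pi :=
    Complex.slitPlane_arg_ne_pi (Or.inr (by simpa using hl.ne'))
  have hs : Complex.sqrt (-Complex.I * l) = starRingEnd ℂ (Complex.sqrt (Complex.I * l)) := by
    rw [← sqrt_conj harg]
    simp
  rw [map_add, Complex.conj_ofReal, ← integral_conj, map_mul,
    ← log_one_add_cpow_conj (re_sqrt_nonneg _), ← hs, Complex.conj_ofNat] at key'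
  simp only [← hconj] at key'
  linear_combination (1 / 2 : ℂ) * key + (1 / 2 : ℂ) * key'
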